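/- For an integer $N \ge 2$ let $\Pi_N = \mathrm{Mon}\langle a, b \mid baa(ba)^N = a\rangle$. An elementary transformation of $\Pi_N$ replaces one occurrence of a side of the defining relation in a word over $\{a,b\}$, as a factor, by the other side; that is, it passes from $pxq$ to $pyq$, where $p, q$ are words and $\{x, y\} = \{baa(ba)^N, a\}$. For $k \ge 1$ set $$U_k = a\,b^{2k}a^{2k}\,a, \qquad V_k = b^{2k-1}a^{2k}\,baa .$$ Then for all $k \ge 1$ and $N \ge 2$ the equality $U_k = V_k$ holds in $\Pi_N$, and the shortest chain of elementary transformations of $\Pi_N$ leading from $U_k$ to $V_k$ has length exactly $$\sigma_N(k) = \frac{2N}{N^2-1}\left(N^{2k}-1\right) + 4k - 2 .$$ -/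

import Mathlib

/-- The two-letter alphabet `{a, b}`. -/
inductive Letter : Type
  | a
  | b
  deriving DecidableEq

/-- One elementary transformation of the monoid presentation `⟨α | R⟩`: a single application, in
either direction, of a defining relation inside a word. -/
def ElemStep {α : Type*} (R : FreeMonoid α → FreeMonoid α → Prop) (u v : FreeMonoid α) : Prop :=
  ∃ p q l r : FreeMonoid α, (R l r ∨ R r l) ∧ u = p * l * q ∧ v = p * r * q

/-- `ChainOfLength R n u v`: there is a chain of exactly `n` elementary transformations of
`⟨α | R⟩` which leads from the word `u` to the word `v`. -/
inductive ChainOfLength {α : Type*} (R : FreeMonoid α → FreeMonoid α → Prop) :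
    ℕ → FreeMonoid α → FreeMonoid α → Prop
  | nil (u : FreeMonoid α) : ChainOfLength R 0 u u
  | cons {n : ℕ} {u v w : FreeMonoid α} (h : ElemStep R u v) (t : ChainOfLength R n v w) :
      ChainOfLength R (n + 1) u w

namespace PiMonoid

/-- The letter `a` as a word. -/
def wa : FreeMonoid Letter := FreeMonoid.of Letter.a

/-- The letter `b` as a word. -/
def wb : FreeMonoid Letter := FreeMonoid.of Letter.b

/-- The only defining relation `baa(ba)^N = a` of `Π_N`. -/
def rel (N : ℕ) (l r : FreeMonoid Letter) : Prop :=
  l = wb * wa * wa * (wb * wa) ^ N ∧ r = wa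

/-- The monoid `Π_N = Mon⟨a, b | baa(ba)^N = a⟩`. -/
abbrev Pi (N : ℕ) : Type := PresentedMonoid (rel N)

/-- The element of `Π_N` represented by a word. -/
def toPi (N : ℕ) : FreeMonoid Letter →* Pi N := PresentedMonoid.mk (rel N)

/-- The word `U_k = a b^{2k} a^{2k} a`. -/
def U (k : ℕ) : FreeMonoid Letter := wa * wb ^ (2 * k) * wa ^ (2 * k) * wa

/-- The word `V_k = b^{2k-1} a^{2k} b a a`, for `k ≥ 1`. -/
def V (k : ℕ) : FreeMonoid Letter := wb ^ (2 * k - 1) * wa ^ (2 * k) * wb * wa * wa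

/-- `σ_N(k) = (2N / (N² - 1)) (N^{2k} - 1) + 4k - 2`. -/
def sigma (N k : ℕ) : ℚ :=
  2 * (N : ℚ) / ((N : ℚ) ^ 2 - 1) * ((N : ℚ) ^ (2 * k) - 1) + 4 * (k : ℚ) - 2

end PiMonoid

/-! The two sides of the relation begin with different letters. Hence a shortest chain need not
touch a common first letter, and if the first letters are `a` and `b` it may open with `a → baac`,
where `c = (ba)^N` (`chain_cases`). The distance thus obeys a deterministic recursion, d(sx, sy) =
d(x, y) and d(ax, by) = 1 + d(aacx, y), which gives upper and lower bounds together. Running it on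
`U` and `V` yields the exact value: `IsDist.rounds` follows the growing powers of `c`, and
`cost_add_eq` sums the cost. -/

namespace ChainOfLength

variable {α : Type*} {R : FreeMonoid α → FreeMonoid α → Prop}

lemma snoc {n : ℕ} {u v w : FreeMonoid α} (h : ChainOfLength R n u v) (s : ElemStep R v w) :
    ChainOfLength R (n + 1) u w := by
  induction h with
  | nil u => exact .cons s (.nil _)
  | cons h _ ih => exact .cons h (ih s)

lemma symm {n : ℕ} {u v : FreeMonoid α} (h : ChainOfLength R n u v) : ChainOfLength R n v u := by
  induction h with
  | nil u => exact .nil _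
  | cons h _ ih =>
    obtain ⟨p, q, l, r, hlr, hu, hv⟩ := h
    exact ih.snoc ⟨p, q, r, l, hlr.symm, hv, hu⟩

end ChainOfLength

section

variable {α : Type*} {R : FreeMonoid α → FreeMonoid α → Prop}

lemma ElemStep.mul_left {u v : FreeMonoid α} (p : FreeMonoid α) (h : ElemStep R u v) :
    ElemStep R (p * u) (p * v) := by
  obtain ⟨p', q, l, r, hlr, rfl, rfl⟩ := h
  exact ⟨p * p', q, l, r, hlr, by simp only [mul_assoc], by simp only [mul_assoc]⟩

lemma ChainOfLength.mul_left {n : ℕ} {u v : FreeMonoid α} (p : FreeMonoid α)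
    (h : ChainOfLength R n u v) : ChainOfLength R n (p * u) (p * v) := by
  induction h with
  | nil u => exact .nil _
  | cons h _ ih => exact .cons (h.mul_left p) ih

lemma ElemStep.mk_eq {u v : FreeMonoid α} (h : ElemStep R u v) :
    PresentedMonoid.mk R u = PresentedMonoid.mk R v := by
  obtain ⟨p, q, l, r, hlr, rfl, rfl⟩ := h
  have key : PresentedMonoid.mk R l = PresentedMonoid.mk R r :=
    hlr.elim PresentedMonoid.mk_eq_mk_of_rel fun h => (PresentedMonoid.mk_eq_mk_of_rel h).symm
  simp only [map_mul, key]

lemma ChainOfLength.mk_eq {n : ℕ} {u v : FreeMonoid α} (h : ChainOfLength R n u v) :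
    PresentedMonoid.mk R u = PresentedMonoid.mk R v := by
  induction h with
  | nil u => rfl
  | cons h _ ih => exact h.mk_eq.trans ih

/-- If an elementary transformation changes a word with first letter `s`, then either it acts
behind the first letter, or it replaces a prefix. -/
lemma ElemStep.of_mul_cases {s : α} {x v : FreeMonoid α}
    (h : ElemStep R (FreeMonoid.of s * x) v) :
    (∃ y, v = FreeMonoid.of s * y ∧ ElemStep R x y) ∨
      ∃ l r q, (R l r ∨ R r l) ∧ FreeMonoid.of s * x = l * q ∧ v = r * q := by
  obtain ⟨p, q, l, r, hlr, hu, rfl⟩ := h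
  induction p using FreeMonoid.casesOn with
  | one => exact .inr ⟨l, r, q, hlr, by simpa using hu, by simp⟩
  | of_mul t p =>
    rw [mul_assoc, mul_assoc] at hu
    have h2 : s = t ∧ x = p * (l * q) := List.cons.inj hu
    obtain ⟨rfl, rfl⟩ := h2
    exact .inl ⟨p * r * q, by simp only [mul_assoc], p, q, l, r, hlr,
      by simp only [mul_assoc], rfl⟩

end

namespace PiMonoid

variable {N : ℕ}

/-! ### Removing first letters from chains -/

/-- The word `(ba)^N`. -/
def wc (N : ℕ) : FreeMonoid Letter := (wb * wa) ^ N

lemma elemStep_wa_mul {x v : FreeMonoid Letter} (h : ElemStep (rel N) (wa * x) v) :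
    (∃ y, v = wa * y ∧ ElemStep (rel N) x y) ∨ v = wb * (wa * wa * wc N * x) := by
  rcases ElemStep.of_mul_cases h with h | ⟨l, r, q, ⟨rfl, rfl⟩ | ⟨rfl, rfl⟩, hu, rfl⟩
  · exact .inl h
  · simp only [mul_assoc] at hu
    have h2 : Letter.a = Letter.b ∧ _ := List.cons.inj hu
    exact absurd h2.1 (by decide)
  · have h2 : Letter.a = Letter.a ∧ x = q := List.cons.inj hu
    obtain ⟨-, rfl⟩ := h2
    exact .inr (by simp only [wc, mul_assoc])

lemma elemStep_wb_mul {x v : FreeMonoid Letter} (h : ElemStep (rel N) (wb * x) v) :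
    (∃ y, v = wb * y ∧ ElemStep (rel N) x y) ∨
      ∃ y, x = wa * wa * wc N * y ∧ v = wa * y := by
  rcases ElemStep.of_mul_cases h with h | ⟨l, r, q, ⟨rfl, rfl⟩ | ⟨rfl, rfl⟩, hu, rfl⟩
  · exact .inl h
  · simp only [mul_assoc] at hu
    have h2 : Letter.b = Letter.b ∧ x = wa * (wa * ((wb * wa) ^ N * q)) := List.cons.inj hu
    exact .inr ⟨q, by rw [h2.2]; simp only [wc, mul_assoc], rfl⟩
  · have h2 : Letter.b = Letter.a ∧ _ := List.cons.inj hu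
    exact absurd h2.1 (by decide)

lemma elemStep_wa_wb (x : FreeMonoid Letter) :
    ElemStep (rel N) (wa * x) (wb * (wa * wa * wc N * x)) :=
  ⟨1, x, wa, _, .inr ⟨rfl, rfl⟩, by simp, by simp only [wc, one_mul, mul_assoc]⟩

lemma exists_chain_of_mul_left_aux {n : ℕ}
    (ih : ∀ m ≤ n, ∀ (s : Letter) (x y : FreeMonoid Letter),
      ChainOfLength (rel N) m (.of s * x) (.of s * y) →
        ∃ m' ≤ m, ChainOfLength (rel N) m' x y)
    (p x y : FreeMonoid Letter) (h : ChainOfLength (rel N) n (p * x) (p * y)) :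
    ∃ m ≤ n, ChainOfLength (rel N) m x y := by
  induction p using FreeMonoid.inductionOn' generalizing n with
  | one => exact ⟨n, le_rfl, by simpa using h⟩
  | of_mul s p hp =>
    rw [mul_assoc, mul_assoc] at h
    obtain ⟨m, hm, h⟩ := ih n le_rfl s _ _ h
    obtain ⟨m', hm', h⟩ := hp (fun j hj => ih j (hj.trans hm)) h
    exact ⟨m', hm'.trans hm, h⟩

/-- Chains between words with a common first letter, and between words with different first
letters, can be replaced by chains that never touch, respectively touch once, the first letter. -/
lemma chain_cases (n : ℕ) :
    (∀ (s : Letter) (x y : FreeMonoid Letter),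
      ChainOfLength (rel N) n (.of s * x) (.of s * y) →
        ∃ m ≤ n, ChainOfLength (rel N) m x y) ∧
    (∀ x y : FreeMonoid Letter, ChainOfLength (rel N) n (wa * x) (wb * y) →
      ∃ m < n, ChainOfLength (rel N) m (wa * wa * wc N * x) y) ∧
    (∀ x y : FreeMonoid Letter, ChainOfLength (rel N) n (wb * x) (wa * y) →
      ∃ m < n, ChainOfLength (rel N) m x (wa * wa * wc N * y)) := by
  induction n using Nat.strong_induction_on with
  | _ n ih =>
  rcases n with _ | n
  · refine ⟨fun s x y h => ?_, fun x y h => ?_, fun x y h => ?_⟩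
    · generalize hu : FreeMonoid.of s * x = u at h
      generalize hv : FreeMonoid.of s * y = v at h
      cases h
      have h2 : s = s ∧ x = y := List.cons.inj (hu.trans hv.symm)
      exact ⟨0, le_rfl, h2.2 ▸ .nil _⟩
    · generalize hu : wa * x = u at h
      generalize hv : wb * y = v at h
      cases h
      have h2 : Letter.a = Letter.b ∧ x = y := List.cons.inj (hu.trans hv.symm)
      exact absurd h2.1 (by decide)
    · generalize hu : wb * x = u at h
      generalize hv : wa * y = v at h
      cases h
      have h2 : Letter.b = Letter.a ∧ x = y := List.cons.inj (hu.trans hv.symm)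
      exact absurd h2.1 (by decide)
  obtain ⟨hA, hB, hC⟩ := ih n n.lt_succ_self
  refine ⟨fun s x y h => ?_, fun x y h => ?_, fun x y h => ?_⟩
  · cases h with | cons h t =>
    cases s with
    | a =>
      rcases elemStep_wa_mul h with ⟨z, rfl, hz⟩ | rfl
      · obtain ⟨m, hm, ht⟩ := hA _ _ _ t
        exact ⟨m + 1, by lia, .cons hz ht⟩
      -- The detour through `b` must return to `a`; both tails then carry the prefix `aac`, which
      -- cancels by strong induction.
      · obtain ⟨m, hm, ht⟩ := hC _ _ t
        obtain ⟨m', hm', ht⟩ := exists_chain_of_mul_left_aux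
          (fun j hj => (ih j (by lia)).1) _ _ _ ht
        exact ⟨m', by lia, ht⟩
    | b =>
      rcases elemStep_wb_mul h with ⟨z, rfl, hz⟩ | ⟨z, rfl, rfl⟩
      · obtain ⟨m, hm, ht⟩ := hA _ _ _ t
        exact ⟨m + 1, by lia, .cons hz ht⟩
      · obtain ⟨m, hm, ht⟩ := hB _ _ t
        exact ⟨m, by lia, ht⟩
  · cases h with | cons h t =>
    rcases elemStep_wa_mul h with ⟨z, rfl, hz⟩ | rfl
    · obtain ⟨m, hm, ht⟩ := hB _ _ t
      exact ⟨m + 1, by lia, .cons (hz.mul_left _) ht⟩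
    · obtain ⟨m, hm, ht⟩ := hA .b _ _ t
      exact ⟨m, by lia, ht⟩
  · cases h with | cons h t =>
    rcases elemStep_wb_mul h with ⟨z, rfl, hz⟩ | ⟨z, rfl, rfl⟩
    · obtain ⟨m, hm, ht⟩ := hC _ _ t
      exact ⟨m + 1, by lia, .cons hz ht⟩
    · obtain ⟨m, hm, ht⟩ := hA .a _ _ t
      exact ⟨m, by lia, ht.mul_left _⟩

/-! ### The recursion for the distance -/

/-- The length of a shortest chain of elementary transformations of `Π_N` from `u` to `v` is `n`. -/
def IsDist (N n : ℕ) (u v : FreeMonoid Letter) : Prop :=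
  IsLeast {m : ℕ | ChainOfLength (rel N) m u v} n

lemma IsDist.refl (u : FreeMonoid Letter) : IsDist N 0 u u :=
  ⟨.nil u, fun _ _ => Nat.zero_le _⟩

lemma IsDist.symm {n : ℕ} {u v : FreeMonoid Letter} (h : IsDist N n u v) : IsDist N n v u :=
  ⟨ChainOfLength.symm h.1, fun _ hm => h.2 (ChainOfLength.symm hm)⟩

/-- Left multiplication is an isometry for the chain distance. -/
lemma IsDist.mul_left {n : ℕ} {x y : FreeMonoid Letter} (p : FreeMonoid Letter)
    (h : IsDist N n x y) : IsDist N n (p * x) (p * y) := by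
  refine ⟨h.1.mul_left p, fun m hm => ?_⟩
  obtain ⟨m', hm', ht⟩ := exists_chain_of_mul_left_aux (fun j _ => (chain_cases j).1) p x y hm
  exact (h.2 ht).trans hm'

/-- Between words with different first letters, a shortest chain may start by changing the first
letter. -/
lemma IsDist.wa_wb {n : ℕ} {x y : FreeMonoid Letter}
    (h : IsDist N n (wa * (wa * wc N * x)) y) : IsDist N (n + 1) (wa * x) (wb * y) := by
  simp only [← mul_assoc] at h
  refine ⟨.cons (elemStep_wa_wb x) (h.1.mul_left wb), fun m hm => ?_⟩
  obtain ⟨m', hm', ht⟩ := (chain_cases m).2.1 x y hm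
  exact Nat.succ_le_of_lt ((h.2 ht).trans_lt hm')

lemma IsDist.wa_pow {g h : FreeMonoid Letter}
    (step : ∀ {n : ℕ} {x y : FreeMonoid Letter}, IsDist N n (wa * (g * x)) y →
      IsDist N (n + 1) (wa * x) (h * y))
    (j : ℕ) {n : ℕ} {x y : FreeMonoid Letter} (hd : IsDist N n (wa * (g ^ j * x)) y) :
    IsDist N (n + j) (wa * x) (h ^ j * y) := by
  induction j generalizing x with
  | zero => simpa using hd
  | succ j ih =>
    rw [pow_succ', mul_assoc, ← add_assoc]
    exact step (ih (by rwa [pow_succ, mul_assoc] at hd))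

lemma IsDist.wa_wb_pow (j : ℕ) {n : ℕ} {x y : FreeMonoid Letter}
    (hd : IsDist N n (wa * ((wa * wc N) ^ j * x)) y) :
    IsDist N (n + j) (wa * x) (wb ^ j * y) :=
  IsDist.wa_pow IsDist.wa_wb j hd

/-- Stripping `b` puts `aac` behind it; one `a` cancels, so each `ba` costs one step and leaves a
`c` behind the leading `a`. -/
lemma IsDist.wa_ba_pow (j : ℕ) {n : ℕ} {x y : FreeMonoid Letter}
    (hd : IsDist N n (wa * (wc N ^ j * x)) y) :
    IsDist N (n + j) (wa * x) ((wb * wa) ^ j * y) := by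
  refine IsDist.wa_pow (fun {n x y} h => ?_) j hd
  rw [mul_assoc]
  refine IsDist.wa_wb ?_
  rw [mul_assoc]
  exact h.mul_left wa

lemma IsDist.wa_wc_pow (j : ℕ) {n : ℕ} {x y : FreeMonoid Letter}
    (hd : IsDist N n (wa * (wc N ^ (N * j) * x)) y) :
    IsDist N (n + N * j) (wa * x) (wc N ^ j * y) := by
  have h := IsDist.wa_ba_pow _ hd
  rwa [pow_mul] at h

/-! ### Distance from `U` to `V` -/

/-- The exponents of `(ba)^N` which occur on the shortest chain. -/
def expo (N : ℕ) : ℕ → ℕ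
  | 0 => 1
  | i + 1 => N * (N * expo N i - 1) + 1

/-- The length of the part of the shortest chain in which the exponent `expo N i` is built up. -/
def cost (N : ℕ) : ℕ → ℕ
  | 0 => 0
  | i + 1 => cost N i + N * expo N i + N * (N * expo N i - 1)

lemma one_le_expo (N i : ℕ) : 1 ≤ expo N i := by
  cases i <;> simp [expo]

/-- Stripping `c^M` turns the right word into `a c^(NM) a y`. Cancelling `ac` leaves `c^(NM-1) a y`
against `acx`; stripping again puts `c^(N(NM-1))` before `cx`. -/
lemma IsDist.round (hN : 1 ≤ N) {M n : ℕ} (hM : 1 ≤ M) {x y : FreeMonoid Letter}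
    (hd : IsDist N n (wc N ^ (N * (N * M - 1) + 1) * x) y) :
    IsDist N (n + N * M + N * (N * M - 1))
      (wc N ^ M * ((wa * wc N) * ((wa * wc N) * x))) (wa * (wa * y)) := by
  obtain ⟨j, hj⟩ : ∃ j, N * M = j + 1 := ⟨N * M - 1, by have := Nat.mul_pos hN hM; lia⟩
  rw [add_right_comm]
  refine (IsDist.wa_wc_pow M (IsDist.symm ?_)).symm
  rw [hj, Nat.add_sub_cancel] at hd
  rw [hj, Nat.add_sub_cancel]
  rw [pow_succ', mul_assoc, mul_assoc, mul_assoc]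
  refine (IsDist.mul_left (wc N) ?_).mul_left wa
  refine IsDist.wa_wc_pow j (IsDist.mul_left wa ?_)
  rwa [pow_succ, mul_assoc] at hd

lemma IsDist.rounds (hN : 1 ≤ N) (i : ℕ) {n : ℕ} {x y : FreeMonoid Letter}
    (hd : IsDist N n (wc N ^ expo N i * x) y) :
    IsDist N (n + cost N i) (wc N * ((wa * wc N) ^ (2 * i) * x)) (wa ^ (2 * i) * y) := by
  induction i generalizing n x y with
  | zero => simpa [expo, cost] using hd
  | succ i ih =>
    have h := ih (IsDist.round hN (one_le_expo N i) hd)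
    convert h using 1
    · simp only [cost]; ring
    · simp only [mul_add, mul_one, pow_add, pow_two, mul_assoc]
    · simp only [mul_add, mul_one, pow_add, pow_two, mul_assoc]

lemma isDist_U_V (hN : 1 ≤ N) (i : ℕ) :
    IsDist N (2 * (cost N i + N * expo N i) + 4 * i + 2) (U (i + 1)) (V (i + 1)) := by
  obtain ⟨j, hj⟩ : ∃ j, N * expo N i = j + 1 :=
    ⟨N * expo N i - 1, by have := Nat.mul_pos hN (one_le_expo N i); lia⟩
  have hc : ∀ m, wc N ^ m = (wb * wa) ^ (N * m) := fun m => by rw [wc, pow_mul]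
  -- The recursion is run backwards, from the point where both words coincide.
  have h0 : IsDist N 0 (wc N ^ (N * expo N i)) (wc N * wc N ^ j) := by
    rw [hj, pow_succ']
    exact .refl _
  have h1 : IsDist N (0 + N * expo N i) (wa * 1)
      (wc N ^ expo N i * (wa * wc N * wc N ^ j)) := by
    refine IsDist.wa_wc_pow _ ?_
    rw [mul_one, mul_assoc]
    exact h0.mul_left wa
  have h2 := IsDist.wa_wb_pow (x := wc N ^ j) (2 * i + 2)
    (y := wa ^ (2 * i + 3)) <| by
      have h := (IsDist.rounds hN i h1.symm).mul_left (wa * wa)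
      have e : wa * ((wa * wc N) ^ (2 * i + 2) * wc N ^ j)
          = wa * wa * (wc N * ((wa * wc N) ^ (2 * i) * (wa * wc N * wc N ^ j))) := by
        rw [pow_succ, pow_succ']
        simp only [mul_assoc]
      have e' : wa ^ (2 * i + 3) = wa * wa * (wa ^ (2 * i) * (wa * 1)) := by
        rw [show 2 * i + 3 = 2 + 2 * i + 1 by ring, pow_succ, pow_add, pow_two]
        simp only [mul_assoc, mul_one]
      rw [e, e']
      exact h
  have h3 := (IsDist.wa_ba_pow (x := 1) j (by rw [mul_one]; exact h2)).symm
  have h4 : IsDist N (0 + N * expo N i + cost N i + (2 * i + 2) + j)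
      (wc N ^ expo N i * (wb ^ (2 * i + 2) * wa ^ (2 * i + 3))) (wb * wa * (wa * 1)) := by
    -- One of the `j + 1` factors `ba` cancels against `baa`, so only `j` are paid for.
    rw [hj] at h3 ⊢
    rw [hc, hj, pow_succ', mul_assoc (wb * wa)]
    exact h3.mul_left (wb * wa)
  have h5 := (IsDist.rounds hN i h4).mul_left (wa * wa)
  have h6 := IsDist.wa_wb_pow (N := N) (2 * i + 1)
    (x := wb ^ (2 * i + 2) * wa ^ (2 * i + 3)) (y := wa * wa * (wa ^ (2 * i) * (wb * wa * (wa * 1))))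
    (by
      rw [pow_succ']
      simp only [mul_assoc] at h5 ⊢
      exact h5)
  convert h6 using 1
  · rw [hj]; ring
  · rw [U, pow_succ wa (2 * i + 2)]
    simp only [mul_assoc, mul_add, mul_one]
  · rw [V, show 2 * (i + 1) - 1 = 2 * i + 1 by lia, show 2 * (i + 1) = 2 + 2 * i by ring,
      pow_add wa, pow_two]
    simp only [mul_assoc, mul_one]

/-! ### Closed forms -/

lemma succ_mul_expo (hN : 1 ≤ N) (i : ℕ) :
    ((N : ℚ) + 1) * expo N i = 1 + (N : ℚ) ^ (2 * i + 1) := by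
  induction i with
  | zero => simp [expo, add_comm]
  | succ i ih =>
    have h : 1 ≤ N * expo N i := Nat.mul_pos hN (one_le_expo N i)
    simp only [expo]
    push_cast [h]
    linear_combination (N : ℚ) ^ 2 * ih

lemma cost_add_eq (hN : 2 ≤ N) (i : ℕ) :
    (2 * ((cost N i : ℚ) + N * expo N i)) =
      2 * (N : ℚ) / ((N : ℚ) ^ 2 - 1) * ((N : ℚ) ^ (2 * (i + 1)) - 1) := by
  have hN' : (2 : ℚ) ≤ N := by exact_mod_cast hN
  have h0 : (N : ℚ) ^ 2 - 1 ≠ 0 := by nlinarith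
  rw [div_mul_eq_mul_div, eq_div_iff h0]
  induction i with
  | zero => simp [cost, expo]
  | succ i ih =>
    have h : 1 ≤ N * expo N i := Nat.mul_pos (by lia) (one_le_expo N i)
    have hs := succ_mul_expo (N := N) (by lia) i
    simp only [cost, expo]
    push_cast [h]
    linear_combination ih + 2 * (N : ℚ) ^ 2 * ((N : ℚ) ^ 2 - 1) * hs

end PiMonoid

theorem mainTheorem2 (N k : ℕ) (hN : 2 ≤ N) (hk : 1 ≤ k) :
    PiMonoid.toPi N (PiMonoid.U k) = PiMonoid.toPi N (PiMonoid.V k) ∧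
      ∃ d : ℕ, (d : ℚ) = PiMonoid.sigma N k ∧
        IsLeast {n : ℕ | ChainOfLength (PiMonoid.rel N) n (PiMonoid.U k) (PiMonoid.V k)} d := by
  obtain ⟨i, rfl⟩ : ∃ i, k = i + 1 := ⟨k - 1, by lia⟩
  have h := PiMonoid.isDist_U_V (N := N) (by lia) i
  refine ⟨ChainOfLength.mk_eq h.1, _, ?_, h⟩
  rw [PiMonoid.sigma, ← PiMonoid.cost_add_eq hN]
  push_cast
  ring
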